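/- Let $\ell_1([0,1])$ be the real Banach space of all functions $x:[0,1]\to\mathbb{R}$ with $\|x\|_1=\sum_{t\in[0,1]}|x(t)|<\infty$. Let $\mathcal{X}$ be a real Banach space, let $T:\ell_1([0,1])\to\mathcal{X}$ be an injective linear operator (boundedness of $T$ is not needed) whose range is separable, and let $\|x\|_T=\|x\|_1+\|T(x)\|_{\mathcal{X}}$ for $x\in\ell_1([0,1])$. Let $r>0$. Then every set $\mathcal{Y}\subseteq\ell_1([0,1])$ whose cardinality is a regular uncountable cardinal and which is $r$-separated, i.e. $\|y-y'\|_T\ge r$ for all distinct $y,y'\in\mathcal{Y}$, has a subset $\mathcal{Z}\subseteq\mathcal{Y}$ of the same cardinality which is $(r+)$-separated, i.e. $\|z-z'\|_T>r$ for all distinct $z,z'\in\mathcal{Z}$. In particular, $(\ell_1([0,1]),\|\cdot\|_T)$ admits no uncountable equilateral set: there is no uncountable $\mathcal{Y}\subseteq\ell_1([0,1])$ for which there is a real $s>0$ with $\|y-y'\|_T=s$ for all distinct $y,y'\in\mathcal{Y}$. -/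

import Mathlib

/-- The real Banach space `ℓ₁([0,1])` of all absolutely summable functions on the closed unit
interval, with its usual norm `‖x‖ = ∑ |x t|`. -/
abbrev EllOne : Type := lp (fun _ : Set.Icc (0 : ℝ) 1 => ℝ) 1

/-- The norm `‖x‖_T = ‖x‖₁ + ‖T x‖` on `ℓ₁([0,1])` induced by a linear operator `T`. -/
noncomputable def normT {X : Type*} [NormedAddCommGroup X] [NormedSpace ℝ X]
    (T : EllOne →ₗ[ℝ] X) (x : EllOne) : ℝ :=
  ‖x‖ + ‖T x‖

/-- `Y` is `r`-separated for the norm `N`: distinct points are at distance at least `r`. -/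
def SeparatedFor {E : Type*} [AddCommGroup E] (N : E → ℝ) (r : ℝ) (Y : Set E) : Prop :=
  ∀ x ∈ Y, ∀ y ∈ Y, x ≠ y → r ≤ N (x - y)

/-- `Y` is `(r+)`-separated for the norm `N`: distinct points are at distance greater
than `r`. -/
def StrictlySeparatedFor {E : Type*} [AddCommGroup E] (N : E → ℝ) (r : ℝ) (Y : Set E) : Prop :=
  ∀ x ∈ Y, ∀ y ∈ Y, x ≠ y → r < N (x - y)

/-- `Y` is equilateral for the norm `N`: for some real `r > 0`, any two distinct points are at
distance exactly `r`. -/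
def EquilateralFor {E : Type*} [AddCommGroup E] (N : E → ℝ) (Y : Set E) : Prop :=
  ∃ r : ℝ, 0 < r ∧ ∀ x ∈ Y, ∀ y ∈ Y, x ≠ y → N (x - y) = r

/-! Let `κ = #Y`. If `#S < κ`, a point with mass below `r / 2` off `S` is coded by a rational
function on `S` and a member of a dense sequence for the range of `T`; `r`-separation makes codes
distinct, so there are fewer than `κ` such points (`mk_massOff_lt_half_lt`). A transfinite selection
then takes each new point with large mass off the supports of its predecessors, and
`two_massOff_add_massOff_le` bounds the distances below. If the masses off some small `S₀` never
exceed `r / 2`, the `ℓ¹`-distances are at least `r` and injectivity of `T` adds a positive term.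
Otherwise the essential supremum of the masses exceeds `r / 2`, and the `ℓ¹`-distances alone exceed
`r`. -/

open Cardinal in
/-- Transfinite selection of length a regular cardinal `κ`: if every set `S ⊇ S₀` of size `< κ`
admits a suitable point, then one can choose a `κ`-sequence of points, each suitable for a set
containing the supports of all its predecessors. -/
theorem exists_seq_of_forall_small {E I : Type} {κ : Cardinal.{0}} (hκ : κ.IsRegular)
    {S₀ : Set I} (hS₀ : #S₀ < κ) (supp : E → Set I) (hsupp : ∀ y, #(supp y) < κ)
    (Q : Set I → E → Prop) (h : ∀ S, S₀ ⊆ S → #S < κ → ∃ y, Q S y) :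
    ∃ (S : κ.ord.ToType → Set I) (y : κ.ord.ToType → E), ∀ a, S₀ ⊆ S a ∧ Q (S a) (y a) ∧
      ∀ b < a, supp (y b) ⊆ S a ∧ S b ⊆ S a := by
  classical
  obtain ⟨y₀, -⟩ := h S₀ subset_rfl hS₀
  let g : Set I → E := fun S => if hS : ∃ y, Q S y then hS.choose else y₀
  have hg : ∀ S, S₀ ⊆ S → #S < κ → Q S (g S) := by
    intro S h1 h2
    have hS := h S h1 h2
    simp only [g, dif_pos hS]
    exact hS.choose_spec
  have wf : WellFounded ((· < ·) : κ.ord.ToType → κ.ord.ToType → Prop) := wellFounded_lt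
  let y : κ.ord.ToType → E :=
    wf.fix fun a ih => g (S₀ ∪ ⋃ b : {b // b < a}, supp (ih b.1 b.2))
  let S : κ.ord.ToType → Set I := fun a => S₀ ∪ ⋃ b : {b // b < a}, supp (y b.1)
  have hy : ∀ a, y a = g (S a) := fun a => wf.fix_eq _ a
  refine ⟨S, y, fun a => ⟨Set.subset_union_left, ?_, fun b hb => ⟨?_, ?_⟩⟩⟩
  · rw [hy]
    refine hg _ Set.subset_union_left ?_
    refine (mk_union_le _ _).trans_lt (add_lt_of_lt hκ.aleph0_le hS₀ ?_)
    refine (card_iUnion_lt_iff_forall_of_isRegular hκ ?_).2 fun b => hsupp _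
    exact (mk_Iio_lt a (by simp)).trans_eq (mk_ord_toType κ)
  · exact (Set.subset_iUnion (fun b : {b // b < a} => supp (y b.1)) ⟨b, hb⟩).trans
      Set.subset_union_right
  · refine Set.union_subset_union_right _ (Set.iUnion_subset fun c => ?_)
    exact Set.subset_iUnion (fun b : {b // b < a} => supp (y b.1)) ⟨c.1, c.2.trans hb⟩

/-! ### Mass off a set: inequalities and approximation. -/

/-- The `ℓ¹`-mass of `y` outside the set `S`. -/
noncomputable def massOff {I : Type*} (S : Set I) (y : I → ℝ) : ℝ :=
  ∑' t, Sᶜ.indicator (fun t => |y t|) t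

theorem massOff_anti {I : Type*} {y : I → ℝ} (hy : Summable fun t => |y t|) {S S' : Set I}
    (h : S ⊆ S') : massOff S' y ≤ massOff S y :=
  (hy.indicator _).tsum_le_tsum
    (fun t => Set.indicator_le_indicator_of_subset (Set.compl_subset_compl.2 h)
      (fun t => abs_nonneg (y t)) t) (hy.indicator _)

theorem massOff_le_tsum {I : Type*} {y : I → ℝ} (hy : Summable fun t => |y t|) (S : Set I) :
    massOff S y ≤ ∑' t, |y t| :=
  (hy.indicator _).tsum_le_tsum (fun t => Set.indicator_le_self' (fun _ _ => abs_nonneg _) t) hy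

/-- Pointwise: off `S`, `y` vanishes and `|x|` occurs in both terms on the right; on `S \ S'`, which
misses `S₀`, use `|y| ≤ |x - y| + |x|`; on `S'` the left side is zero. -/
theorem two_massOff_add_massOff_le {I : Type*} {x y : I → ℝ} (hx : Summable fun t => |x t|)
    (hy : Summable fun t => |y t|) {S₀ S S' : Set I} (h₀ : S₀ ⊆ S') (h : S' ⊆ S)
    (hsupp : Function.support y ⊆ S) :
    2 * massOff S x + massOff S' y ≤ (∑' t, |x t - y t|) + massOff S₀ x := by
  have hxy : Summable fun t => |x t - y t| :=
    .of_nonneg_of_le (fun _ => abs_nonneg _) (fun t => abs_sub _ _) (hx.add hy)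
  have i := fun S : Set I => hx.indicator Sᶜ
  have j := fun S : Set I => hy.indicator Sᶜ
  unfold massOff
  rw [← tsum_mul_left, ← ((i S).mul_left 2).tsum_add (j S'), ← hxy.tsum_add (i S₀)]
  refine (((i S).mul_left 2).add (j S')).tsum_le_tsum (fun t => ?_) (hxy.add (i S₀))
  by_cases h1 : t ∈ S
  · by_cases h2 : t ∈ S₀
    · simp [h1, h2, h₀ h2]
    · have := abs_sub_abs_le_abs_sub (y t) (x t)
      rw [abs_sub_comm (y t)] at this
      by_cases h3 : t ∈ S' <;> simp [h1, h2, h3] <;> first | positivity | linarith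
  · have hyt : y t = 0 := by
      by_contra hne
      exact h1 (hsupp hne)
    have h3 : t ∉ S' := fun h' => h1 (h h')
    have h2 : t ∉ S₀ := fun h' => h3 (h₀ h')
    simp [h1, h2, h3, hyt]
    linarith

/-- A summable function is approximated by a finitely supported rational function on `S` up to
its mass outside `S`. -/
theorem exists_finsupp_tsum_lt {I : Type*} {y : I → ℝ} (hy : Summable fun t => |y t|) (S : Set I)
    {ε : ℝ} (hε : 0 < ε) :
    ∃ f : S →₀ ℚ, (Summable fun t => |y t - Function.extend Subtype.val (fun s => (f s : ℝ)) 0 t|) ∧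
      ∑' t, |y t - Function.extend Subtype.val (fun s => (f s : ℝ)) 0 t| < massOff S y + ε := by
  classical
  obtain ⟨s, hs⟩ : ∃ s : Finset I, (∑' t, |y t|) - ε / 2 < ∑ t ∈ s, |y t| :=
    (hy.hasSum.eventually (lt_mem_nhds (by linarith))).exists
  set δ : ℝ := ε / 2 / (s.card + 1) with hδ
  have hδ0 : 0 < δ := by positivity
  have hq : ∀ t, ∃ q : ℚ, |y t - q| < δ := fun t => exists_rat_near _ hδ0
  choose q hq using hq
  let f : S →₀ ℚ := Finsupp.onFinset (s.subtype (· ∈ S)) (fun t => if t.1 ∈ s then q t else 0)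
    (fun t ht => by
      simp only [ne_eq, ite_eq_right_iff, not_forall] at ht
      simpa using ht.1)
  have i1 : Summable fun t => Sᶜ.indicator (fun t => |y t|) t := hy.indicator _
  have i2 : Summable fun t => (s : Set I).indicator (fun _ => δ) t :=
    summable_of_hasFiniteSupport ((s.finite_toSet).subset (by simp))
  have i3 : Summable fun t => (s : Set I).indicator (fun t => |y t|) t := hy.indicator _
  -- The three errors: mass off `S`, rounding on `s`, and the tail off `s`.
  have bound : ∀ t, |y t - Function.extend Subtype.val (fun s => (f s : ℝ)) 0 t| ≤
      Sᶜ.indicator (fun t => |y t|) t + (s : Set I).indicator (fun _ => δ) t +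
        (|y t| - (s : Set I).indicator (fun t => |y t|) t) := by
    intro t
    by_cases h1 : t ∈ S
    · have : Function.extend Subtype.val (fun s => (f s : ℝ)) 0 t = (f ⟨t, h1⟩ : ℝ) :=
        Subtype.val_injective.extend_apply (fun s : S => (f s : ℝ)) 0 ⟨t, h1⟩
      rw [this]
      by_cases h2 : t ∈ s
      · simpa [f, h1, h2] using (hq t).le
      · simp [f, h1, h2]
    · have : Function.extend Subtype.val (fun s => (f s : ℝ)) 0 t = 0 := by
        rw [Function.extend_apply']
        · rfl
        · rintro ⟨a, rfl⟩
          exact h1 a.2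
      rw [this]
      by_cases h2 : t ∈ s <;> simp [h1, h2, hδ0.le]
  have sm : Summable fun t => |y t - Function.extend Subtype.val (fun s => (f s : ℝ)) 0 t| :=
    .of_nonneg_of_le (fun _ => abs_nonneg _) bound ((i1.add i2).add (hy.sub i3))
  refine ⟨f, sm, (sm.tsum_le_tsum bound ((i1.add i2).add (hy.sub i3))).trans_lt ?_⟩
  rw [(i1.add i2).tsum_add (hy.sub i3), i1.tsum_add i2, hy.tsum_sub i3]
  have e2 : ∑' t, (s : Set I).indicator (fun _ => δ) t = s.card * δ := by
    rw [← tsum_subtype]; simp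
  have e3 : ∑' t, (s : Set I).indicator (fun t => |y t|) t = ∑ t ∈ s, |y t| := by
    rw [← tsum_subtype]; exact Finset.tsum_subtype s (fun t => |y t|)
  have e4 : s.card * δ < ε / 2 := by
    rw [hδ, mul_div_assoc', div_lt_iff₀ (by positivity)]
    nlinarith
  change massOff S y + _ + _ < _
  linarith

/-! ### Counting points with little mass off a small set. -/

namespace EllOne

theorem summable_abs (y : EllOne) : Summable fun t => |y t| := by
  simpa using (lp.memℓp y).summable (by simp)

theorem norm_eq_tsum (y : EllOne) : ‖y‖ = ∑' t, |y t| := by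
  simpa using lp.norm_eq_tsum_rpow (by simp) y

theorem countable_support (y : EllOne) : (Function.support y).Countable := by
  simpa [Function.support] using (summable_abs y).countable_support

end EllOne

open Cardinal in
theorem mk_finsupp_rat_lt {I : Type} {κ : Cardinal.{0}} (hκ : ℵ₀ < κ) {S : Set I}
    (hS : #S < κ) : #(S →₀ ℚ) < κ := by
  rcases isEmpty_or_nonempty S with h | h
  · rw [mk_eq_one]
    exact one_lt_aleph0.trans hκ
  · rw [mk_finsupp_of_infinite']
    exact max_lt hS (by simpa using hκ)

open Cardinal in
/-- In an `r`-separated set, all but fewer than `κ` points have mass at least `r / 2` outside a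
given set of size `< κ`. -/
theorem mk_massOff_lt_half_lt {X : Type*} [NormedAddCommGroup X] [NormedSpace ℝ X]
    (T : EllOne →ₗ[ℝ] X) (hsep : TopologicalSpace.IsSeparable (Set.range T)) {r : ℝ}
    {Y : Set EllOne} (hY : SeparatedFor (normT T) r Y) {κ : Cardinal.{0}} (hκ : ℵ₀ < κ)
    {S : Set (Set.Icc (0 : ℝ) 1)} (hS : #S < κ) :
    #{y ∈ Y | massOff S y < r / 2} < κ := by
  obtain ⟨c, hc, hcT⟩ := hsep
  have hcne : c.Nonempty := by
    rw [← closure_nonempty_iff]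
    exact (Set.range_nonempty T).mono hcT
  obtain ⟨u, rfl⟩ := hc.exists_eq_range hcne
  -- Recording the slack `1 / (k + 1)` in the code makes the four errors of two points with equal
  -- codes add up to less than `r`.
  have code : ∀ y : {y ∈ Y | massOff S y < r / 2}, ∃ p : ℕ × (S →₀ ℚ) × ℕ,
      (Summable fun t => |y.1 t - Function.extend Subtype.val (fun s => (p.2.1 s : ℝ)) 0 t|) ∧
      ∑' t, |y.1 t - Function.extend Subtype.val (fun s => (p.2.1 s : ℝ)) 0 t| <
        r / 2 - 1 / (p.1 + 1) ∧ ‖T y.1 - u p.2.2‖ < 1 / (p.1 + 1) := by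
    rintro ⟨y, hyY, hy⟩
    obtain ⟨k, hk⟩ := exists_nat_one_div_lt (show 0 < (r / 2 - massOff S y) / 2 by linarith)
    obtain ⟨f, hf, hf'⟩ := exists_finsupp_tsum_lt (EllOne.summable_abs y) S
      (show 0 < (r / 2 - massOff S y) / 2 by linarith)
    obtain ⟨_, ⟨j, rfl⟩, hj⟩ := Metric.mem_closure_iff.1 (hcT ⟨y, rfl⟩) (1 / ((k : ℝ) + 1))
      (by positivity)
    exact ⟨(k, f, j), hf, by dsimp only; linarith, by rwa [← dist_eq_norm]⟩
  choose p hp1 hp2 hp3 using code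
  have hinj : Function.Injective p := by
    intro y z hyz
    by_contra hne
    have hsep := hY y.1 y.2.1 z.1 z.2.1 fun h => hne (Subtype.ext h)
    have a1 := hp1 z
    have a2 := hp2 z
    have a3 := hp3 z
    rw [← hyz] at a1 a2 a3
    set e : Set.Icc (0 : ℝ) 1 → ℝ :=
      Function.extend Subtype.val (fun s => ((p y).2.1 s : ℝ)) 0
    have b1 : ‖y.1 - z.1‖ ≤ ∑' t, |y.1 t - e t| + ∑' t, |z.1 t - e t| := by
      rw [EllOne.norm_eq_tsum, ← (hp1 y).tsum_add a1]
      refine (EllOne.summable_abs _).tsum_le_tsum (fun t => ?_) ((hp1 y).add a1)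
      have := abs_sub_le (y.1 t) (e t) (z.1 t)
      rwa [abs_sub_comm (e t)] at this
    have b2 : ‖T (y.1 - z.1)‖ ≤ ‖T y.1 - u (p y).2.2‖ + ‖T z.1 - u (p y).2.2‖ := by
      rw [map_sub, ← sub_sub_sub_cancel_right _ _ (u (p y).2.2)]
      exact norm_sub_le _ _
    have := hp2 y
    have := hp3 y
    unfold normT at hsep
    linarith
  refine (mk_le_of_injective hinj).trans_lt ?_
  rw [mk_prod, mk_prod]
  simp only [lift_id, mk_nat]
  exact mul_lt_of_lt hκ.le hκ (mul_lt_of_lt hκ.le (mk_finsupp_rat_lt hκ hS) hκ)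

/-! ### Extraction of strictly separated subsets. -/

open Cardinal in
/-- If there is a transfinite selection whose points are pairwise at distance greater than `r`,
then there is a strictly separated subset of full size. -/
theorem exists_strictlySeparatedFor_of_seq {X : Type*} [NormedAddCommGroup X] [NormedSpace ℝ X]
    {T : EllOne →ₗ[ℝ] X} {r : ℝ} (hr : 0 < r) {Y : Set EllOne} {κ : Cardinal.{0}}
    (y : κ.ord.ToType → EllOne) (hyY : ∀ a, y a ∈ Y)
    (hy : ∀ a, ∀ b < a, r < normT T (y a - y b)) :
    ∃ Z : Set EllOne, Z ⊆ Y ∧ #Z = κ ∧ StrictlySeparatedFor (normT T) r Z := by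
  have hne : ∀ a, ∀ b < a, y a ≠ y b := by
    intro a b hab h
    have := hy a b hab
    simp only [h, normT, sub_self, map_zero, norm_zero, add_zero] at this
    linarith
  have hinj : Function.Injective y := by
    intro a b hab
    rcases lt_trichotomy a b with h | h | h
    · exact absurd hab.symm (hne _ _ h)
    · exact h
    · exact absurd hab (hne _ _ h)
  refine ⟨Set.range y, Set.range_subset_iff.2 hyY, ?_, ?_⟩
  · rw [mk_range_eq _ hinj, mk_ord_toType]
  · rintro _ ⟨a, rfl⟩ _ ⟨b, rfl⟩ hab
    rcases lt_trichotomy a b with h | h | h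
    · have := hy _ _ h
      unfold normT at this ⊢
      rwa [map_sub, norm_sub_rev, norm_sub_rev (T _), ← map_sub] at this
    · exact absurd (by rw [h]) hab
    · exact hy _ _ h

open Cardinal in
theorem exists_strictlySeparatedFor_of_norm_le {X : Type*} [NormedAddCommGroup X]
    [NormedSpace ℝ X] (T : EllOne →ₗ[ℝ] X) (hinj : Function.Injective T)
    (hsep : TopologicalSpace.IsSeparable (Set.range T)) {r : ℝ} (hr : 0 < r) {Y : Set EllOne}
    (hY : SeparatedFor (normT T) r Y) (hreg : (#Y).IsRegular) (hunc : ℵ₀ < #Y) {C : ℝ}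
    (hC : ∀ y ∈ Y, ‖y‖ ≤ C) :
    ∃ Z : Set EllOne, Z ⊆ Y ∧ #Z = #Y ∧ StrictlySeparatedFor (normT T) r Z := by
  set κ := #Y with hκ
  have hsupp : ∀ y : Y, #(Function.support (y : EllOne)) < κ := fun y =>
    (le_aleph0_iff_set_countable.2 (EllOne.countable_support y.1)).trans_lt hunc
  have key : ∀ {x y : EllOne} {S₀ S S' : Set (Set.Icc (0 : ℝ) 1)}, S₀ ⊆ S' → S' ⊆ S →
      Function.support y ⊆ S → 2 * massOff S x + massOff S' y ≤ ‖x - y‖ + massOff S₀ x := by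
    intro x y S₀ S S' h₀ h h'
    have := two_massOff_add_massOff_le (EllOne.summable_abs x) (EllOne.summable_abs y) h₀ h h'
    rw [EllOne.norm_eq_tsum]
    simpa using this
  by_cases hA : ∃ S₀ : Set (Set.Icc (0 : ℝ) 1), #S₀ < κ ∧ ∀ y ∈ Y, massOff S₀ y ≤ r / 2
  · obtain ⟨S₀, hS₀, hle⟩ := hA
    obtain ⟨S, y, h⟩ := exists_seq_of_forall_small hreg hS₀
      (fun y : Y => Function.support (y : EllOne)) hsupp
      (fun S y => r / 2 ≤ massOff S (y : EllOne)) (by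
        intro S _ hS
        by_contra! hcon
        refine (mk_massOff_lt_half_lt T hsep hY hunc hS).ne ?_
        rw [hκ]
        congr 2
        ext y
        exact ⟨fun h => h.1, fun h => ⟨h, hcon ⟨y, h⟩⟩⟩)
    have hdist : ∀ a, ∀ b < a, r ≤ ‖(y a : EllOne) - y b‖ := by
      intro a b hab
      have h1 := key (x := y a) (y := y b) (h b).1 ((h a).2.2 b hab).2 ((h a).2.2 b hab).1
      have h2 := hle _ (y a).2
      have h3 := (h a).2.1
      have h4 := (h b).2.1
      linarith
    refine exists_strictlySeparatedFor_of_seq hr (fun a => (y a : EllOne)) (fun a => (y a).2) ?_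
    intro a b hab
    have h1 := hdist a b hab
    have h2 : 0 < ‖T ((y a : EllOne) - y b)‖ := by
      rw [norm_pos_iff, Ne, map_eq_zero_iff T hinj, ← norm_eq_zero]
      linarith
    unfold normT
    linarith
  · push Not at hA
    -- `sSup P` is the essential supremum of the masses, modulo sets of size `< κ`.
    let P : Set ℝ := {ρ | ∀ S : Set (Set.Icc (0 : ℝ) 1), #S < κ → ∃ y ∈ Y, ρ < massOff S y}
    have hP : BddAbove P := by
      refine ⟨C, fun ρ hρ => ?_⟩
      obtain ⟨y, hy, h⟩ := hρ ∅ (by simpa using hreg.pos)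
      have := massOff_le_tsum (EllOne.summable_abs y) ∅
      rw [← EllOne.norm_eq_tsum] at this
      linarith [hC y hy]
    -- Otherwise each `k` has a small set witnessing failure; by regularity their union is small,
    -- and off it all masses are at most `r / 2`, against `hA`.
    obtain ⟨k, hk⟩ : ∃ k : ℕ, r / 2 + 1 / ((k : ℝ) + 1) ∈ P := by
      by_contra! hcon
      simp only [P, Set.mem_ofPred_eq, not_forall, not_exists, not_and, not_lt] at hcon
      choose S hS hle using hcon
      obtain ⟨y, hy, hlt⟩ := hA (⋃ k, S k)
        ((card_iUnion_lt_iff_forall_of_isRegular hreg (by simpa using hunc)).2 hS)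
      obtain ⟨k, hk⟩ := exists_nat_one_div_lt (sub_pos.2 hlt)
      have h1 := hle k y hy
      have h2 := massOff_anti (EllOne.summable_abs y) (Set.subset_iUnion S k)
      linarith
    have hρ : r / 2 < sSup P := by
      have := le_csSup hP hk
      have : 0 < 1 / ((k : ℝ) + 1) := by positivity
      linarith
    -- The distances will exceed `3 * (sSup P - δ) - (sSup P + δ)`.
    obtain ⟨δ, hδ, hδr⟩ : ∃ δ > 0, r < 2 * sSup P - 4 * δ :=
      ⟨(sSup P - r / 2) / 4, by linarith, by linarith⟩
    have hup : sSup P + δ ∉ P := fun h => by linarith [le_csSup hP h]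
    simp only [P, Set.mem_ofPred_eq, not_forall, not_exists, not_and, not_lt] at hup
    obtain ⟨S₀, hS₀, hle⟩ := hup
    obtain ⟨ρ, hρP, hρlt⟩ := exists_lt_of_lt_csSup ⟨_, hk⟩ (sub_lt_self (sSup P) hδ)
    obtain ⟨S, y, h⟩ := exists_seq_of_forall_small hreg hS₀
      (fun y : Y => Function.support (y : EllOne)) hsupp
      (fun S y => ρ < massOff S (y : EllOne)) (fun S _ hS => by
        obtain ⟨y, hy, h⟩ := hρP S hS
        exact ⟨⟨y, hy⟩, h⟩)
    refine exists_strictlySeparatedFor_of_seq hr (fun a => (y a : EllOne)) (fun a => (y a).2) ?_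
    intro a b hab
    have h1 := key (x := y a) (y := y b) (h b).1 ((h a).2.2 b hab).2 ((h a).2.2 b hab).1
    have h2 := hle _ (y a).2
    have h3 := (h a).2.1
    have h4 := (h b).2.1
    have h5 := norm_nonneg (T ((y a : EllOne) - y b))
    unfold normT
    linarith

open Cardinal in
theorem exists_strictlySeparatedFor {X : Type*} [NormedAddCommGroup X]
    [NormedSpace ℝ X] (T : EllOne →ₗ[ℝ] X) (hinj : Function.Injective T)
    (hsep : TopologicalSpace.IsSeparable (Set.range T)) {r : ℝ} (hr : 0 < r) {Y : Set EllOne}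
    (hY : SeparatedFor (normT T) r Y) (hreg : (#Y).IsRegular) (hunc : ℵ₀ < #Y) :
    ∃ Z : Set EllOne, Z ⊆ Y ∧ #Z = #Y ∧ StrictlySeparatedFor (normT T) r Z := by
  -- By regularity one of countably many balls catches `#Y` points.
  obtain ⟨n, hn⟩ : ∃ n : ℕ, #{y ∈ Y | ‖y‖ ≤ n} = #Y := by
    by_contra! hcon
    have hlt : ∀ n : ℕ, #{y ∈ Y | ‖y‖ ≤ n} < #Y := fun n =>
      (mk_le_mk_of_subset fun y hy => hy.1).lt_of_ne (hcon n)
    have := (card_iUnion_lt_iff_forall_of_isRegular hreg (by simpa using hunc)).2 hlt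
    refine this.not_ge (mk_le_mk_of_subset fun y hy => ?_)
    obtain ⟨n, hn⟩ := exists_nat_ge ‖y‖
    exact Set.mem_iUnion.2 ⟨n, hy, hn⟩
  rw [← hn] at hreg hunc ⊢
  obtain ⟨Z, hZ, hcard, hsepZ⟩ := exists_strictlySeparatedFor_of_norm_le T hinj hsep hr
    (fun x hx y hy => hY x hx.1 y hy.1) hreg hunc (fun y hy => hy.2)
  exact ⟨Z, fun z hz => (hZ hz).1, hcard, hsepZ⟩

theorem theorem3 {X : Type*} [NormedAddCommGroup X] [NormedSpace ℝ X] [CompleteSpace X]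
    (T : EllOne →ₗ[ℝ] X) (hinj : Function.Injective T)
    (hsep : TopologicalSpace.IsSeparable (Set.range T)) :
    (∀ r : ℝ, 0 < r → ∀ Y : Set EllOne, SeparatedFor (normT T) r Y →
      (Cardinal.mk Y).IsRegular → Cardinal.aleph0 < Cardinal.mk Y →
      ∃ Z : Set EllOne, Z ⊆ Y ∧ Cardinal.mk Z = Cardinal.mk Y ∧
        StrictlySeparatedFor (normT T) r Z) ∧
    ¬ ∃ Y : Set EllOne, ¬ Y.Countable ∧ EquilateralFor (normT T) Y := by
  refine ⟨fun r hr Y hY hreg hunc => exists_strictlySeparatedFor T hinj hsep hr hY hreg hunc, ?_⟩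
  rintro ⟨Y, hY, r, hr, heq⟩
  have hle : Cardinal.aleph 1 ≤ Cardinal.mk Y := by
    rw [← Cardinal.succ_aleph0, Order.succ_le_iff, ← not_le, Cardinal.le_aleph0_iff_set_countable]
    exact hY
  -- `#Y` may be singular, so pass to a subset of size `ℵ₁`.
  obtain ⟨Y', hY', hcard⟩ := Cardinal.le_mk_iff_exists_subset.1 hle
  obtain ⟨Z, hZ, hZcard, hZsep⟩ := exists_strictlySeparatedFor T hinj hsep hr (Y := Y')
    (fun x hx y hy hxy => (heq x (hY' hx) y (hY' hy) hxy).ge)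
    (hcard ▸ Cardinal.isRegular_aleph_one) (hcard ▸ Cardinal.aleph0_lt_aleph_one)
  have hZnt : Z.Nontrivial := by
    rw [← Set.nontrivial_coe_sort, ← Cardinal.one_lt_iff_nontrivial, hZcard, hcard]
    exact Cardinal.one_lt_aleph0.trans Cardinal.aleph0_lt_aleph_one
  obtain ⟨x, hx, y, hy, hxy⟩ := hZnt
  exact (hZsep x hx y hy hxy).ne' (heq x (hY' (hZ hx)) y (hY' (hZ hy)) hxy)
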